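/- Let $G$ be a (discrete) group. Write $\ell^1(G)$ for the Banach algebra of absolutely summable functions $G\to\mathbb{C}$ with the convolution product $(f*g)(t)=\sum_{s\in G} f(s)g(s^{-1}t)$, and $\delta_s$ for the point mass at $s\in G$. For a Banach algebra $A$, the first Arens product $\Box$ on $A^{**}$ is defined by $\langle \Psi\Box\Phi,\lambda\rangle=\langle\Psi,\Phi\cdot\lambda\rangle$, $\langle a,\Phi\cdot\lambda\rangle=\langle\Phi,\lambda\cdot a\rangle$, $\langle b,\lambda\cdot a\rangle=\langle ab,\lambda\rangle$ for $\Phi,\Psi\in A^{**}$, $\lambda\in A^*$, $a,b\in A$. An invariant mean on $G$ is an $M\in\ell^1(G)^{**}$ with $\|M\|=\langle M,1\rangle=1$ and $\delta_s\Box M=M$ for all $s\in G$, and $G$ is amenable if it has an invariant mean. An invariant difference on $G$ is a $\Gamma\in\ell^1(G)^{**}$ with $\delta_s\Box\Gamma=\Gamma$ for all $s\in G$ and $\langle\Gamma,1\rangle=0$. Let $\mathcal{D}(G)$ be the set of invariant differences on $G$. For a subgroup $H\le G$, regard $\mathcal{D}(H)\subseteq\ell^1(H)^{**}$ as a subset of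 $\ell^1(G)^{**}$ through the second adjoint of the inclusion $\ell^1(H)\hookrightarrow\ell^1(G)$ (extension by zero). Set $$A_{sn}(G)=\operatorname{span}\{\Gamma_1\Box\cdots\Box\Gamma_n : n\ge 1,\ \Gamma_i\in\mathcal{D}(H_i)\text{ for some subnormal subgroup } H_i\text{ of }G\ (i=1,\dots,n)\},$$ $$J_{sn}(G)=\operatorname{span}\{\Phi\Box\Gamma : \Phi\in\ell^1(G)^{**},\ \Gamma\in\mathcal{D}(H)\text{ for some subnormal subgroup } H\text{ of }G\},$$ and for a linear subspace $B\subseteq\ell^1(G)^{**}$ set $B^{\Box 2}=\operatorname{span}\{\Phi\Box\Psi:\Phi,\Psi\in B\}$. A group is just infinite if it is infinite and each of its non-trivial normal subgroups has finite index. It is hereditarily just infinite if each of its non-trivial normal subgroups is just infinite. Theorem. Let $G$ be an amenable just infinite group. Then the following are equivalent: (1) $G$ is hereditarily just infinite; (2) $J_{sn}(G)^{\Box 2}=\{0\}$; (3) $A_{sn}(G)^{\Box 2}=\{0\}$. -/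

import Mathlib

namespace InvDiff

noncomputable section

/-! ### Just infinite groups -/

/-- A group is just infinite if it is infinite and every non-trivial normal subgroup has finite
index. -/
def JustInfinite (G : Type*) [Group G] : Prop :=
  Infinite G ∧ ∀ N : Subgroup G, N.Normal → N ≠ ⊥ → N.FiniteIndex

/-- A group is hereditarily just infinite if every non-trivial normal subgroup is just infinite. -/
def HereditarilyJustInfinite (G : Type*) [Group G] : Prop :=
  ∀ N : Subgroup G, N.Normal → N ≠ ⊥ → JustInfinite N

/-! ### The first Arens product -/

section Arens

variable {A : Type*} [NormedAddCommGroup A] [NormedSpace ℂ A]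

/-- The functional `λ · a` on `A`, given by `⟨b, λ · a⟩ = ⟨a b, λ⟩`, as a function of `a`.
Here `m` is the multiplication of the Banach algebra `A`. -/
def dualAct (m : A →L[ℂ] A →L[ℂ] A) : StrongDual ℂ A →L[ℂ] A →L[ℂ] StrongDual ℂ A :=
  ((ContinuousLinearMap.compL ℂ A (A →L[ℂ] A) (A →L[ℂ] ℂ)).flip m).comp
    (ContinuousLinearMap.compL ℂ A A ℂ)

/-- The functional `Φ · λ` on `A`, given by `⟨a, Φ · λ⟩ = ⟨Φ, λ · a⟩`, as a function of `λ`. -/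
def bidualAct (m : A →L[ℂ] A →L[ℂ] A) (Φ : StrongDual ℂ (StrongDual ℂ A)) :
    StrongDual ℂ A →L[ℂ] StrongDual ℂ A :=
  (ContinuousLinearMap.compL ℂ A (StrongDual ℂ A) ℂ Φ).comp (dualAct m)

/-- The first Arens product `Ψ □ Φ` on `A**`, given by `⟨Ψ □ Φ, λ⟩ = ⟨Ψ, Φ · λ⟩`. -/
def arens (m : A →L[ℂ] A →L[ℂ] A) (Ψ Φ : StrongDual ℂ (StrongDual ℂ A)) :
    StrongDual ℂ (StrongDual ℂ A) :=
  Ψ.comp (bidualAct m Φ)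

theorem dualAct_apply (m : A →L[ℂ] A →L[ℂ] A) (l : StrongDual ℂ A) (a b : A) :
    dualAct m l a b = l (m a b) := rfl

theorem bidualAct_apply (m : A →L[ℂ] A →L[ℂ] A) (Φ : StrongDual ℂ (StrongDual ℂ A))
    (l : StrongDual ℂ A) (a : A) : bidualAct m Φ l a = Φ (dualAct m l a) := rfl

theorem arens_apply (m : A →L[ℂ] A →L[ℂ] A) (Ψ Φ : StrongDual ℂ (StrongDual ℂ A))
    (l : StrongDual ℂ A) : arens m Ψ Φ l = Ψ (bidualAct m Φ l) := rfl

end Arens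

/-! ### The Banach algebra `ℓ¹(G)` -/

/-- The Banach space `ℓ¹(X)` of absolutely summable complex functions on `X`. -/
abbrev Ell1 (X : Type*) : Type _ := lp (fun _ : X => ℂ) 1

/-- The second dual of `ℓ¹(X)`. -/
abbrev Bidual (X : Type*) : Type _ := StrongDual ℂ (StrongDual ℂ (Ell1 X))

section Ell1

theorem Ell1.summable {X : Type*} (f : Ell1 X) : Summable fun x => ‖f x‖ := by
  simpa using (lp.memℓp f).summable (by simp)

theorem Ell1.norm_eq {X : Type*} (f : Ell1 X) : ‖f‖ = ∑' x, ‖f x‖ := by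
  simpa using lp.norm_eq_tsum_rpow (p := 1) (by simp) f

theorem memℓp_one_of_summable {X : Type*} {f : X → ℂ} (h : Summable fun x => ‖f x‖) :
    Memℓp (E := fun _ : X => ℂ) f 1 :=
  memℓp_gen (by simpa using h)

/-- Extension by zero, as a bounded linear map `ℓ¹(Y) → ℓ¹(X)`, along an injective map. -/
def extendZero {X Y : Type*} (i : Y → X) (hi : Function.Injective i) : Ell1 Y →L[ℂ] Ell1 X :=
  have key : ∀ f : Ell1 Y, HasSum (fun x => ‖Function.extend i (⇑f) 0 x‖) ‖f‖ := fun f => by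
    have h : HasSum (fun y => ‖f y‖) ‖f‖ := by
      rw [Ell1.norm_eq]; exact (Ell1.summable f).hasSum
    refine (hi.hasSum_iff (fun x hx => ?_)).1 ?_
    · rw [Function.extend_apply' _ _ _ (by simpa using hx)]; simp
    · convert h using 2
      simp [hi.extend_apply]
  LinearMap.mkContinuous
    { toFun := fun f => ⟨Function.extend i (⇑f) 0, memℓp_one_of_summable (key f).summable⟩
      map_add' := fun f g => by
        ext x
        change Function.extend i (⇑f + ⇑g) 0 x
          = Function.extend i (⇑f) 0 x + Function.extend i (⇑g) 0 x
        by_cases hx : ∃ y, i y = x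
        · obtain ⟨y, rfl⟩ := hx
          rw [hi.extend_apply, hi.extend_apply, hi.extend_apply]
          rfl
        · rw [Function.extend_apply' _ _ _ hx, Function.extend_apply' _ _ _ hx,
            Function.extend_apply' _ _ _ hx]
          simp
      map_smul' := fun c f => by
        ext x
        by_cases hx : ∃ y, i y = x
        · obtain ⟨y, rfl⟩ := hx
          simp [hi.extend_apply]
        · simp [Function.extend_apply' _ _ _ hx] } 1
    (fun f => by
      rw [one_mul, Ell1.norm_eq]
      exact (key f).tsum_eq.le)

/-- The constant function `1` in `ℓ^∞(G) = ℓ¹(G)*`, i.e. the functional `f ↦ ∑ t, f(t)`. -/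
def constOne {G : Type*} : StrongDual ℂ (Ell1 G) :=
  lp.tsumCLM ℂ G ℂ

theorem constOne_apply {G : Type*} (f : Ell1 G) : constOne f = ∑' t, f t := rfl

variable {G : Type*} [Group G]

theorem conv_summable (f g : Ell1 G) :
    Summable fun p : G × G => ‖f p.1 * g (p.1⁻¹ * p.2)‖ := by
  have h : Summable fun p : G × G => ‖f p.1‖ * ‖g p.2‖ :=
    (Ell1.summable f).mul_of_nonneg (Ell1.summable g) (fun _ => norm_nonneg _)
      (fun _ => norm_nonneg _)
  have h' := ((Equiv.prodShear (Equiv.refl G) (fun s : G => Equiv.mulLeft s⁻¹)).summable_iff).2 h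
  refine h'.congr (fun p => ?_)
  simp [Equiv.prodShear]

theorem conv_summable_right (f g : Ell1 G) (t : G) :
    Summable fun s => f s * g (s⁻¹ * t) :=
  Summable.of_norm (((Equiv.prodComm G G).summable_iff.2 (conv_summable f g)).prod_factor t)

theorem conv_norm_hasSum (f g : Ell1 G) :
    (Summable fun t => ‖∑' s, f s * g (s⁻¹ * t)‖) ∧
      ∑' t, ‖∑' s, f s * g (s⁻¹ * t)‖ ≤ ‖f‖ * ‖g‖ := by
  have h1 : Summable fun q : G × G => ‖f q.2 * g (q.2⁻¹ * q.1)‖ :=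
    (Equiv.prodComm G G).summable_iff.2 (conv_summable f g)
  have hle : ∀ t, ‖∑' s, f s * g (s⁻¹ * t)‖ ≤ ∑' s, ‖f s * g (s⁻¹ * t)‖ := fun t =>
    norm_tsum_le_tsum_norm (h1.prod_factor t)
  have hs : Summable fun t => ‖∑' s, f s * g (s⁻¹ * t)‖ :=
    Summable.of_nonneg_of_le (fun _ => norm_nonneg _) hle h1.prod
  refine ⟨hs, (hs.tsum_le_tsum hle h1.prod).trans ?_⟩
  have h2 : ∑' t, ∑' s, ‖f s * g (s⁻¹ * t)‖ = ∑' s, ∑' t, ‖f s * g (s⁻¹ * t)‖ :=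
    Summable.tsum_comm (f := fun s t => ‖f s * g (s⁻¹ * t)‖) (conv_summable f g)
  rw [h2, Ell1.norm_eq f, ← tsum_mul_right]
  refine le_of_eq (tsum_congr fun s => ?_)
  simp_rw [norm_mul]
  rw [tsum_mul_left, Ell1.norm_eq g]
  congr 1
  exact (Equiv.mulLeft s⁻¹).tsum_eq (fun t => ‖g t‖)

/-- Convolution `(f * g)(t) = ∑ s, f(s) g(s⁻¹ t)` on `ℓ¹(G)`, as a bounded bilinear map. -/
def conv : Ell1 G →L[ℂ] Ell1 G →L[ℂ] Ell1 G :=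
  LinearMap.mkContinuous₂
    (LinearMap.mk₂ ℂ
      (fun f g => (⟨fun t => ∑' s, f s * g (s⁻¹ * t),
        memℓp_one_of_summable (conv_norm_hasSum f g).1⟩ : Ell1 G))
      (fun f f' g => by
        ext t
        change ∑' s, (f s + f' s) * g (s⁻¹ * t)
          = ∑' s, f s * g (s⁻¹ * t) + ∑' s, f' s * g (s⁻¹ * t)
        simpa [add_mul] using
          (conv_summable_right f g t).tsum_add (conv_summable_right f' g t))
      (fun c f g => by
        ext t
        simp [mul_assoc, tsum_mul_left])
      (fun f g g' => by
        ext t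
        change ∑' s, f s * (g (s⁻¹ * t) + g' (s⁻¹ * t))
          = ∑' s, f s * g (s⁻¹ * t) + ∑' s, f s * g' (s⁻¹ * t)
        simpa [mul_add] using
          (conv_summable_right f g t).tsum_add (conv_summable_right f g' t))
      (fun c f g => by
        ext t
        simp [mul_left_comm, tsum_mul_left]))
    1
    (fun f g => by
      rw [one_mul, Ell1.norm_eq]
      exact (conv_norm_hasSum f g).2)

theorem conv_apply (f g : Ell1 G) (t : G) : conv f g t = ∑' s, f s * g (s⁻¹ * t) := rfl

end Ell1

/-! ### Invariant means and invariant differences -/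

section Invariant

variable {G : Type*} [Group G]

/-- The first Arens product on `ℓ¹(G)**`. -/
def box (Ψ Φ : Bidual G) : Bidual G := arens conv Ψ Φ

open Classical in
/-- The point mass `δ_s`, regarded as an element of `ℓ¹(G)**`. -/
def delta (s : G) : Bidual G :=
  NormedSpace.inclusionInDoubleDual ℂ (Ell1 G) (lp.single 1 s (1 : ℂ))

variable (G) in
/-- A (discrete) group is amenable if it has a left-invariant mean: a functional `M` on `ℓ^∞(G)`
with `‖M‖ = ⟨M, 1⟩ = 1` and `δ_s □ M = M` for all `s`. -/
def Amenable : Prop :=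
  ∃ M : Bidual G, ‖M‖ = 1 ∧ M constOne = 1 ∧ ∀ s : G, box (delta s) M = M

variable (G) in
/-- The set `D(G)` of invariant differences on `G`. -/
def invariantDifferences : Set (Bidual G) :=
  {Γ | (∀ s : G, box (delta s) Γ = Γ) ∧ Γ constOne = 0}

/-- For a subgroup `H` of `G`, the second adjoint `ℓ¹(H)** → ℓ¹(G)**` of the inclusion
`ℓ¹(H) → ℓ¹(G)`. -/
def bidualIncl (H : Subgroup G) (Φ : Bidual H) : Bidual G :=
  Φ.comp ((ContinuousLinearMap.compL ℂ (Ell1 H) (Ell1 G) ℂ).flip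
    (extendZero (Subtype.val : H → G) Subtype.val_injective))

theorem bidualIncl_apply (H : Subgroup G) (Φ : Bidual H) (l : StrongDual ℂ (Ell1 G)) :
    bidualIncl H Φ l = Φ (l.comp (extendZero (Subtype.val : H → G) Subtype.val_injective)) := rfl

variable (G) in
/-- The invariant differences on the subnormal subgroups of `G`, regarded as elements of
`ℓ¹(G)**`. -/
def snDifferences : Set (Bidual G) :=
  {Γ | ∃ H : Subgroup G, H.IsSubnormal ∧ ∃ Γ' ∈ invariantDifferences H, Γ = bidualIncl H Γ'}

variable (G) in
/-- The algebra `A_sn(G)`: the linear span of all products `Γ₁ □ ⋯ □ Γₙ` (`n ≥ 1`) of invariant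
differences on subnormal subgroups of `G`. -/
def Asn : Submodule ℂ (Bidual G) :=
  Submodule.span ℂ {Λ | ∃ Γ₁ ∈ snDifferences G, ∃ L : List (Bidual G),
    (∀ Γ ∈ L, Γ ∈ snDifferences G) ∧ Λ = L.foldl box Γ₁}

variable (G) in
/-- The left ideal `J_sn(G)`: the linear span of all products `Φ □ Γ` with `Φ ∈ ℓ¹(G)**` and `Γ` an
invariant difference on a subnormal subgroup of `G`. -/
def Jsn : Submodule ℂ (Bidual G) :=
  Submodule.span ℂ {Λ | ∃ Φ : Bidual G, ∃ Γ ∈ snDifferences G, Λ = box Φ Γ}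

/-- The power `B^{□2}`: the linear span of all products `Φ □ Ψ` with `Φ, Ψ ∈ B`. -/
def boxSq (B : Submodule ℂ (Bidual G)) : Submodule ℂ (Bidual G) :=
  Submodule.span ℂ {Λ | ∃ Φ ∈ B, ∃ Ψ ∈ B, Λ = box Φ Ψ}

end Invariant

end

end InvDiff

/-! (1) ⇒ (2): let Γ and Δ be invariant differences on subgroups H and K of finite index. The
function t ↦ ⟨Ψ □ Δ, l(t ·)⟩ is right invariant under the normal core of K, because in tnu =
tu(u⁻¹nu) the factor u⁻¹nu lies in K and is absorbed by Δ. So this function and its translates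
factor through a finite quotient of G. Summing the translates of such a function over the quotient
gives a multiple of 1, so Γ annihilates it and (Φ □ Γ) □ (Ψ □ Δ) = 0 (`box_box_eq_zero`). Under (1)
every non-trivial subnormal subgroup has finite index, and the trivial one carries no non-zero
invariant difference. (2) ⇒ (3) holds because `Asn G ≤ Jsn G`.

(3) ⇒ (1): if (1) fails, some non-trivial normal N has a non-trivial normal subgroup of infinite
index. Finitely many conjugates of it meet trivially, which yields infinite subnormal H and K with
trivial intersection (`JustInfinite.exists_isSubnormal_inf_eq_bot`). Both inherit invariant means,
hence carry non-zero invariant differences Γ and Δ (`IsInvariantMean.exists_invariantDifference`).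
As (h, k) ↦ hk is injective, a function of the form hk ↦ l(h) l'(k) detects Γ □ Δ ≠ 0. -/

namespace InvDiff

noncomputable section

/-! ### Point masses and bounded operators on ℓ¹. -/

section Functions

open Classical in
/-- The point mass at `x`, as an element of `ℓ¹(X)`. -/
def pointMass {X : Type*} (x : X) : Ell1 X := lp.single 1 x (1 : ℂ)

theorem norm_pointMass {X : Type*} (x : X) : ‖pointMass x‖ = 1 := by
  classical
  unfold pointMass
  rw [lp.norm_single (by simp)]
  simp

theorem pointMass_self {X : Type*} (x : X) : pointMass x x = 1 := by
  classical
  exact lp.single_apply_self (E := fun _ : X => ℂ) 1 x 1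

theorem pointMass_of_ne {X : Type*} {x y : X} (h : y ≠ x) : pointMass x y = 0 := by
  classical
  exact lp.single_apply_ne (E := fun _ : X => ℂ) 1 x 1 h

/-- Bounded operators on `ℓ¹(X)` which agree on all point masses are equal. -/
theorem clm_ext {X E : Type*} [NormedAddCommGroup E] [NormedSpace ℂ E] {f g : Ell1 X →L[ℂ] E}
    (h : ∀ x, f (pointMass x) = g (pointMass x)) : f = g := by
  classical
  refine lp.ext_continuousLinearMap (by simp) fun x => ?_
  refine ContinuousLinearMap.ext_ring ?_
  have := h x
  simpa [pointMass] using this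

/-- The bounded operator on `ℓ¹(X)` with prescribed bounded values at the point masses. -/
def ofBounded {X E : Type*} [NormedAddCommGroup E] [NormedSpace ℂ E] [CompleteSpace E]
    (v : X → E) (C : ℝ) (hv : ∀ x, ‖v x‖ ≤ C) : Ell1 X →L[ℂ] E :=
  have hb : ∀ (f : Ell1 X) x, ‖f x • v x‖ ≤ ‖f x‖ * C := fun f x => by
    rw [norm_smul]
    exact mul_le_mul_of_nonneg_left (hv x) (norm_nonneg _)
  have hs : ∀ f : Ell1 X, Summable fun x => ‖f x • v x‖ := fun f =>
    Summable.of_nonneg_of_le (fun _ => norm_nonneg _) (hb f) ((Ell1.summable f).mul_right C)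
  LinearMap.mkContinuous
    { toFun := fun f => ∑' x, f x • v x
      map_add' := fun f g => by
        rw [← (hs f).of_norm.tsum_add (hs g).of_norm]
        refine tsum_congr fun x => ?_
        rw [← add_smul]
        rfl
      map_smul' := fun c f => by
        rw [RingHom.id_apply, ← (hs f).of_norm.tsum_const_smul]
        refine tsum_congr fun x => ?_
        rw [smul_smul]
        rfl } C
    (fun f => by
      refine (norm_tsum_le_tsum_norm (hs f)).trans ?_
      refine ((hs f).tsum_le_tsum (hb f) ((Ell1.summable f).mul_right C)).trans ?_
      rw [tsum_mul_right, Ell1.norm_eq, mul_comm])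

theorem ofBounded_pointMass {X E : Type*} [NormedAddCommGroup E] [NormedSpace ℂ E]
    [CompleteSpace E] (v : X → E) (C : ℝ) (hv : ∀ x, ‖v x‖ ≤ C) (x : X) :
    ofBounded v C hv (pointMass x) = v x := by
  change ∑' y, pointMass x y • v y = v x
  rw [tsum_eq_single x fun y hy => by rw [pointMass_of_ne hy, zero_smul], pointMass_self, one_smul]

theorem norm_apply_pointMass_le {X : Type*} (l : StrongDual ℂ (Ell1 X)) (x : X) :
    ‖l (pointMass x)‖ ≤ ‖l‖ := by
  simpa [norm_pointMass] using l.le_opNorm (pointMass x)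

/-- The operator `ℓ¹(X) → ℓ¹(Y)` induced by a map `X → Y`. -/
def pushforward {X Y : Type*} (φ : X → Y) : Ell1 X →L[ℂ] Ell1 Y :=
  ofBounded (fun x => pointMass (φ x)) 1 fun _ => (norm_pointMass _).le

theorem pushforward_pointMass {X Y : Type*} (φ : X → Y) (x : X) :
    pushforward φ (pointMass x) = pointMass (φ x) :=
  ofBounded_pointMass _ _ _ x

/-- The adjoint `ℓ^∞(Y) → ℓ^∞(X)` of an operator `ℓ¹(X) → ℓ¹(Y)`. -/
def adj {X Y : Type*} (T : Ell1 X →L[ℂ] Ell1 Y) :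
    StrongDual ℂ (Ell1 Y) →L[ℂ] StrongDual ℂ (Ell1 X) :=
  (ContinuousLinearMap.compL ℂ (Ell1 X) (Ell1 Y) ℂ).flip T

theorem adj_apply {X Y : Type*} (T : Ell1 X →L[ℂ] Ell1 Y) (l : StrongDual ℂ (Ell1 Y)) :
    adj T l = l.comp T := rfl

theorem constOne_pointMass {X : Type*} (x : X) : constOne (pointMass x) = 1 := by
  rw [constOne_apply]
  have h : ∑' y, pointMass x y = pointMass x x := tsum_eq_single x fun y hy => pointMass_of_ne hy
  rw [h, pointMass_self]

theorem extendZero_pointMass {X Y : Type*} (i : Y → X) (hi : Function.Injective i) (y : Y) :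
    extendZero i hi (pointMass y) = pointMass (i y) := by
  ext x
  change Function.extend i (⇑(pointMass y)) 0 x = _
  by_cases hx : ∃ z, i z = x
  · obtain ⟨z, rfl⟩ := hx
    rw [hi.extend_apply]
    by_cases hz : z = y
    · rw [hz, pointMass_self, pointMass_self]
    · rw [pointMass_of_ne hz, pointMass_of_ne (hi.ne hz)]
  · rw [Function.extend_apply' _ _ _ hx, pointMass_of_ne fun h => hx ⟨y, h.symm⟩, Pi.zero_apply]

end Functions

/-! ### Translations, and vanishing of products over subgroups of finite index. -/

section Groups

variable {G : Type*} [Group G]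

theorem conv_pointMass (s t : G) : conv (pointMass s) (pointMass t) = pointMass (s * t) := by
  ext u
  rw [conv_apply, tsum_eq_single s fun y hy => by rw [pointMass_of_ne hy, zero_mul],
    pointMass_self, one_mul]
  by_cases hu : u = s * t
  · rw [hu, inv_mul_cancel_left, pointMass_self, pointMass_self]
  · rw [pointMass_of_ne hu, pointMass_of_ne]
    rintro rfl
    exact hu (by group)

/-- The left translate `t ↦ l (s t)` of a functional. -/
def translate (s : G) (l : StrongDual ℂ (Ell1 G)) : StrongDual ℂ (Ell1 G) :=
  dualAct conv l (pointMass s)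

theorem translate_pointMass (s t : G) (l : StrongDual ℂ (Ell1 G)) :
    translate s l (pointMass t) = l (pointMass (s * t)) := by
  rw [translate, dualAct_apply, conv_pointMass]

theorem translate_translate (s t : G) (l : StrongDual ℂ (Ell1 G)) :
    translate t (translate s l) = translate (s * t) l :=
  clm_ext fun u => by simp only [translate_pointMass, mul_assoc]

theorem translate_one (l : StrongDual ℂ (Ell1 G)) : translate 1 l = l :=
  clm_ext fun u => by rw [translate_pointMass, one_mul]

theorem translate_constOne (s : G) : translate s (constOne : StrongDual ℂ (Ell1 G)) = constOne :=
  clm_ext fun u => by rw [translate_pointMass, constOne_pointMass, constOne_pointMass]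

/-- The functional `Φ · l`, written as a function on `G`. -/
theorem bidualAct_pointMass (Φ : Bidual G) (l : StrongDual ℂ (Ell1 G)) (s : G) :
    bidualAct conv Φ l (pointMass s) = Φ (translate s l) := rfl

theorem box_apply (Ψ Φ : Bidual G) (l : StrongDual ℂ (Ell1 G)) :
    box Ψ Φ l = Ψ (bidualAct conv Φ l) := rfl

theorem box_delta (s : G) (Φ : Bidual G) (l : StrongDual ℂ (Ell1 G)) :
    box (delta s) Φ l = Φ (translate s l) := by
  classical
  have h : pointMass s = lp.single 1 s (1 : ℂ) := by
    unfold pointMass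
    congr
  rw [translate, h]
  rfl

theorem box_delta_one (Φ : Bidual G) : box (delta 1) Φ = Φ :=
  ContinuousLinearMap.ext fun l => by rw [box_delta, translate_one]

theorem box_delta_eq_iff (s : G) (Φ : Bidual G) :
    box (delta s) Φ = Φ ↔ ∀ l, Φ (translate s l) = Φ l := by
  rw [ContinuousLinearMap.ext_iff]
  simp only [box_delta]

/-- Restriction of functionals from `ℓ¹(G)` to `ℓ¹(H)`. -/
def restrict (H : Subgroup G) (l : StrongDual ℂ (Ell1 G)) : StrongDual ℂ (Ell1 H) :=
  l.comp (extendZero (Subtype.val : H → G) Subtype.val_injective)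

theorem restrict_pointMass (H : Subgroup G) (l : StrongDual ℂ (Ell1 G)) (h : H) :
    restrict H l (pointMass h) = l (pointMass (h : G)) := by
  rw [restrict, ContinuousLinearMap.comp_apply, extendZero_pointMass]

theorem bidualIncl_eq (H : Subgroup G) (Φ : Bidual H) (l : StrongDual ℂ (Ell1 G)) :
    bidualIncl H Φ l = Φ (restrict H l) := rfl

theorem bidualIncl_translate {H : Subgroup G} {Γ : Bidual H} (hΓ : Γ ∈ invariantDifferences H)
    (h : H) (l : StrongDual ℂ (Ell1 G)) :
    bidualIncl H Γ (translate (h : G) l) = bidualIncl H Γ l := by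
  rw [bidualIncl_eq, bidualIncl_eq, ← (box_delta_eq_iff h Γ).1 (hΓ.1 h) (restrict H l)]
  congr 1
  exact clm_ext fun u => by
    simp only [translate_pointMass, restrict_pointMass, Subgroup.coe_mul]

/-- An invariant difference annihilates the functions which are constant on the cosets of a normal
subgroup of finite index. -/
theorem invariantDifference_eq_zero {Γ : Bidual G} (hΓ : Γ ∈ invariantDifferences G)
    (N : Subgroup G) [N.Normal] [N.FiniteIndex] {l : StrongDual ℂ (Ell1 G)}
    (hl : ∀ s, ∀ n ∈ N, l (pointMass (s * n)) = l (pointMass s)) : Γ l = 0 := by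
  have := Subgroup.fintypeQuotientOfFiniteIndex (H := N)
  let F : G ⧸ N → ℂ := Quotient.lift (fun s => l (pointMass s)) fun a b hab => by
    have hab' : a⁻¹ * b ∈ N := QuotientGroup.leftRel_apply.1 hab
    change l (pointMass a) = l (pointMass b)
    rw [← hl a _ hab', mul_inv_cancel_left]
  have hF : ∀ s : G, l (pointMass s) = F s := fun s => rfl
  -- Right multiplication by s permutes the quotient, so the sum does not depend on s.
  have hsum : ∑ q : G ⧸ N, translate q.out l = (∑ q, F q) • constOne := by
    refine clm_ext fun s => ?_
    rw [sum_apply, smul_apply, constOne_pointMass,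
      smul_eq_mul, mul_one]
    simp only [translate_pointMass, hF, QuotientGroup.mk_mul, QuotientGroup.out_eq']
    exact Equiv.sum_comp (Equiv.mulRight (s : G ⧸ N)) F
  have h := congrArg Γ hsum
  rw [map_sum, map_smul, hΓ.2, smul_zero] at h
  simp only [(box_delta_eq_iff _ Γ).1 (hΓ.1 _), Finset.sum_const, Finset.card_univ] at h
  exact (smul_eq_zero.1 h).resolve_left Fintype.card_ne_zero

/-- The restriction to H is constant on the cosets of N ∩ H, which is normal of finite index in H.
-/
theorem bidualIncl_eq_zero {H : Subgroup G} {Γ : Bidual H} (hΓ : Γ ∈ invariantDifferences H)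
    (N : Subgroup G) [N.Normal] [N.FiniteIndex] {l : StrongDual ℂ (Ell1 G)}
    (hl : ∀ s, ∀ n ∈ N, l (pointMass (s * n)) = l (pointMass s)) : bidualIncl H Γ l = 0 := by
  rw [bidualIncl_eq]
  refine invariantDifference_eq_zero hΓ (N.subgroupOf H) fun s n hn => ?_
  rw [restrict_pointMass, restrict_pointMass, Subgroup.coe_mul]
  exact hl _ _ (Subgroup.mem_subgroupOf.1 hn)

/-- Invariant differences on two subgroups of finite index generate left ideals with trivial
product. -/
theorem box_box_eq_zero {H K : Subgroup G} [H.FiniteIndex] [K.FiniteIndex] {Γ : Bidual H}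
    {Δ : Bidual K} (hΓ : Γ ∈ invariantDifferences H) (hΔ : Δ ∈ invariantDifferences K)
    (Φ Ψ : Bidual G) : box (box Φ (bidualIncl H Γ)) (box Ψ (bidualIncl K Δ)) = 0 := by
  ext l
  rw [box_apply, box_apply, zero_apply]
  convert map_zero Φ
  refine clm_ext fun s => ?_
  rw [bidualAct_pointMass, zero_apply]
  refine bidualIncl_eq_zero hΓ K.normalCore fun t n hn => ?_
  rw [translate_pointMass, translate_pointMass, bidualAct_pointMass, bidualAct_pointMass,
    box_apply, box_apply]
  congr 1
  refine clm_ext fun u => ?_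
  rw [bidualAct_pointMass, bidualAct_pointMass, translate_translate, translate_translate]
  -- Moving n to the right past u conjugates it, which is why the normal core of K is used rather
  -- than K.
  have hn' : u⁻¹ * n * u ∈ K := K.normalCore_le <| by
    simpa using (inferInstance : K.normalCore.Normal).conj_mem n hn u⁻¹
  rw [← bidualIncl_translate hΔ ⟨_, hn'⟩ (translate (s * t * u) l), translate_translate]
  congr 2
  group

theorem eq_zero_of_invariantDifference_of_eq_bot {H : Subgroup G} (hH : H = ⊥) {Γ : Bidual H}
    (hΓ : Γ ∈ invariantDifferences H) : bidualIncl H Γ = 0 := by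
  subst hH
  ext l
  rw [bidualIncl_eq, zero_apply]
  refine invariantDifference_eq_zero hΓ ⊥ fun s n hn => ?_
  rw [Subgroup.mem_bot.1 hn, mul_one]

/-! ### Bilinearity of □ and squares of spans. -/

theorem box_add_left (Ψ Ψ' Φ : Bidual G) : box (Ψ + Ψ') Φ = box Ψ Φ + box Ψ' Φ := rfl

theorem box_smul_left (c : ℂ) (Ψ Φ : Bidual G) : box (c • Ψ) Φ = c • box Ψ Φ := rfl

theorem box_zero_left (Φ : Bidual G) : box 0 Φ = 0 := rfl

theorem box_add_right (Ψ Φ Φ' : Bidual G) : box Ψ (Φ + Φ') = box Ψ Φ + box Ψ Φ' :=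
  ContinuousLinearMap.ext fun l => map_add Ψ (bidualAct conv Φ l) (bidualAct conv Φ' l)

theorem box_smul_right (c : ℂ) (Ψ Φ : Bidual G) : box Ψ (c • Φ) = c • box Ψ Φ :=
  ContinuousLinearMap.ext fun l => map_smul Ψ c (bidualAct conv Φ l)

theorem box_zero_right (Ψ : Bidual G) : box Ψ 0 = 0 :=
  ContinuousLinearMap.ext fun _ => map_zero Ψ

theorem boxSq_mono {A B : Submodule ℂ (Bidual G)} (h : A ≤ B) : boxSq A ≤ boxSq B :=
  Submodule.span_mono <| by
    rintro _ ⟨Φ, hΦ, Ψ, hΨ, rfl⟩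
    exact ⟨Φ, h hΦ, Ψ, h hΨ, rfl⟩

/-- The square of a span vanishes as soon as all products of generators vanish. -/
theorem boxSq_span_eq_bot {S : Set (Bidual G)} (h : ∀ Φ ∈ S, ∀ Ψ ∈ S, box Φ Ψ = 0) :
    boxSq (Submodule.span ℂ S) = ⊥ := by
  rw [boxSq, Submodule.span_eq_bot]
  rintro _ ⟨Φ, hΦ, Ψ, hΨ, rfl⟩
  induction hΦ using Submodule.span_induction with
  | zero => exact box_zero_left Ψ
  | add Φ Φ' _ _ h₁ h₂ => rw [box_add_left, h₁, h₂, add_zero]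
  | smul c Φ _ h₁ => rw [box_smul_left, h₁, smul_zero]
  | mem Φ hΦ =>
    induction hΨ using Submodule.span_induction with
    | zero => exact box_zero_right Φ
    | add Ψ Ψ' _ _ h₁ h₂ => rw [box_add_right, h₁, h₂, add_zero]
    | smul c Ψ _ h₁ => rw [box_smul_right, h₁, smul_zero]
    | mem Ψ hΨ => exact h Φ hΦ Ψ hΨ

theorem snDifferences_subset_Asn : snDifferences G ⊆ Asn G := fun Γ hΓ =>
  Submodule.subset_span ⟨Γ, hΓ, [], by simp, rfl⟩

/-- Split off the last factor of a product; a single factor is multiplied by δ₁ on the left. -/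
theorem Asn_le_Jsn : Asn G ≤ Jsn G := by
  refine Submodule.span_mono ?_
  rintro _ ⟨Γ, hΓ, L, hL, rfl⟩
  induction L using List.reverseRecOn with
  | nil => exact ⟨delta 1, Γ, hΓ, (box_delta_one Γ).symm⟩
  | append_singleton L Δ _ =>
    exact ⟨L.foldl box Γ, Δ, hL Δ (by simp), by rw [List.foldl_append]; rfl⟩

end Groups

end

end InvDiff

namespace InvDiff

/-! ### Subnormal subgroups of just infinite groups. -/

section GroupTheory

open scoped commutatorElement

variable {G : Type*} [Group G]

/-- Schur's theorem: a commutator depends only on the classes of its entries modulo the center, so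
there are finitely many commutators, and then they generate a finite group. -/
theorem finite_commutator_of_finiteIndex_center [(Subgroup.center G).FiniteIndex] :
    Finite (commutator G) := by
  have : Finite (commutatorSet G) := by
    let Q := G ⧸ Subgroup.center G
    refine Set.Finite.subset (Set.finite_range fun p : Q × Q => ⁅p.1.out, p.2.out⁆) ?_
    rintro _ ⟨a, b, rfl⟩
    refine ⟨((a : Q), (b : Q)), ?_⟩
    obtain ⟨z, hz⟩ := QuotientGroup.mk_out_eq_mul (Subgroup.center G) a
    obtain ⟨w, hw⟩ := QuotientGroup.mk_out_eq_mul (Subgroup.center G) b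
    have h₁ := Subgroup.mem_center_iff.1 z.2
    have h₂ := Subgroup.mem_center_iff.1 w.2
    change ⁅(a : Q).out, (b : Q).out⁆ = ⁅a, b⁆
    rw [hz, hw, commutatorElement_def, commutatorElement_def, mul_inv_rev, mul_inv_rev]
    calc a * z * (b * w) * ((z : G)⁻¹ * a⁻¹) * ((w : G)⁻¹ * b⁻¹)
        = a * (z * (b * w)) * ((z : G)⁻¹ * a⁻¹) * ((w : G)⁻¹ * b⁻¹) := by group
      _ = a * b * (w * a⁻¹) * ((w : G)⁻¹ * b⁻¹) := by rw [← h₁ (b * w)]; group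
      _ = a * b * a⁻¹ * b⁻¹ := by rw [← h₂ a⁻¹]; group
  infer_instance

theorem JustInfinite.eq_bot_of_finite (hG : JustInfinite G) {N : Subgroup G} (hN : N.Normal)
    [Finite N] : N = ⊥ := by
  by_contra h
  have := hG.2 N hN h
  have := hG.1
  exact not_finite_iff_infinite.2 ‹_›
    ((Subgroup.finite_iff_finite_and_finiteIndex N).2 ⟨‹_›, ‹_›⟩)

/-- A just infinite group has no non-trivial elements of finite order with finitely many
conjugates. -/
theorem JustInfinite.eq_one_of_isOfFinOrder (hG : JustInfinite G) {x : G} (hx : IsOfFinOrder x)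
    [(Subgroup.centralizer {x}).FiniteIndex] : x = 1 := by
  let C := (Subgroup.centralizer {x}).normalCore
  let D := Subgroup.centralizer (C : Set G)
  have hxD : x ∈ D := Subgroup.mem_centralizer_iff.2 fun c hc =>
    ((Subgroup.mem_centralizer_iff.1 ((Subgroup.centralizer {x}).normalCore_le hc)) x rfl).symm
  have hDC : C.subgroupOf D ≤ Subgroup.center D := fun d hd =>
    Subgroup.mem_center_iff.2 fun e => Subtype.ext
      (Subgroup.mem_centralizer_iff.1 e.2 d (Subgroup.mem_subgroupOf.1 hd)).symm
  -- C ∩ D is central and of finite index in D, so [D, D] is finite by Schur's theorem. It is normal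
  -- in G, hence trivial.
  have : (Subgroup.center D).FiniteIndex := Subgroup.finiteIndex_of_le hDC
  have := finite_commutator_of_finiteIndex_center (G := D)
  have hcomm : IsMulCommutative D := by
    rw [← Subgroup.commutator_self_eq_bot_iff]
    have : Finite (⁅D, D⁆ : Subgroup G) := by
      rw [← Subgroup.map_subtype_commutator]
      exact Finite.of_surjective _ (D.subtype.subgroupMap_surjective (commutator D))
    exact hG.eq_bot_of_finite inferInstance
  have hconj : (Group.conjugatesOfSet {x}).Finite := by
    refine Set.Finite.subset (Set.finite_range
      fun q : G ⧸ Subgroup.centralizer {x} => q.out * x * q.out⁻¹) fun y hy => ?_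
    obtain ⟨a, ha, h⟩ := Group.mem_conjugatesOfSet_iff.1 hy
    rw [Set.mem_singleton_iff.1 ha] at h
    obtain ⟨c, rfl⟩ := isConj_iff.1 h
    refine ⟨(c : G ⧸ _), ?_⟩
    obtain ⟨z, hz⟩ := QuotientGroup.mk_out_eq_mul (Subgroup.centralizer {x}) c
    have h := Subgroup.mem_centralizer_iff.1 z.2 x rfl
    change (c : G ⧸ Subgroup.centralizer {x}).out * x * _ = _
    rw [hz, mul_assoc c, ← h]
    group
  have hle : Subgroup.normalClosure {x} ≤ D :=
    Subgroup.normalClosure_le_normal (Set.singleton_subset_iff.2 hxD)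
  have hab : ∀ a ∈ D, ∀ b ∈ D, Commute a b := fun a ha b hb =>
    congrArg Subtype.val (hcomm.is_comm.comm ⟨a, ha⟩ ⟨b, hb⟩)
  have htor : ∀ y ∈ Subgroup.normalClosure {x}, IsOfFinOrder y := by
    intro y hy
    have hy' : y ∈ Subgroup.closure (Group.conjugatesOfSet {x}) := hy
    induction hy' using Subgroup.closure_induction with
    | mem y h =>
      obtain ⟨a, ha, h⟩ := Group.mem_conjugatesOfSet_iff.1 h
      rw [Set.mem_singleton_iff.1 ha] at h
      obtain ⟨c, rfl⟩ := isConj_iff.1 h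
      exact (MulAut.conj c).toMonoidHom.isOfFinOrder hx
    | one => exact IsOfFinOrder.one
    | mul a b ha hb h₁ h₂ => exact (hab a (hle ha) b (hle hb)).isOfFinOrder_mul (h₁ ha) (h₂ hb)
    | inv a ha h₁ => exact (h₁ ha).inv
  -- The normal closure is abelian and generated by finitely many elements of finite order.
  have hfin : Finite (Subgroup.normalClosure {x}) := by
    let _ : CommGroup (Subgroup.normalClosure {x}) :=
      { mul_comm := fun a b => Subtype.ext (hab a (hle a.2) b (hle b.2)) }
    have : Finite (Group.conjugatesOfSet {x}) := hconj
    have : Group.FG (Subgroup.normalClosure {x}) :=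
      Group.closure_finite_fg (Group.conjugatesOfSet {x})
    exact CommGroup.finite_of_fg_isMulTorsion _ fun y => Submonoid.isOfFinOrder_coe.1 (htor y y.2)
  have h1 := hG.eq_bot_of_finite (N := Subgroup.normalClosure {x}) inferInstance
  exact Subgroup.mem_bot.1 (h1 ▸ Subgroup.subset_normalClosure rfl)

/-- A just infinite group has no non-trivial finite subgroups with normalizer of finite index. -/
theorem JustInfinite.eq_bot_of_finite_of_normal (hG : JustInfinite G) {M L : Subgroup G}
    [L.FiniteIndex] (hML : M ≤ L) (hn : ∀ g ∈ L, ∀ x ∈ M, g * x * g⁻¹ ∈ M) [Finite M] :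
    M = ⊥ := by
  rw [eq_bot_iff]
  intro x hx
  have : (M.subgroupOf L).Normal := ⟨fun a ha g => hn g g.2 a ha⟩
  have : Finite (M.subgroupOf L) :=
    Finite.of_injective (fun a : M.subgroupOf L => (⟨(a : L), a.2⟩ : M)) fun a b h =>
      Subtype.ext (Subtype.ext (Subtype.mk.inj h))
  have : Finite (MulAut (M.subgroupOf L)) :=
    Finite.of_injective (fun f : MulAut (M.subgroupOf L) => (f : _ → _)) DFunLike.coe_injective
  -- The kernel of the conjugation action on the finite group M has finite index and centralizes
  -- every x ∈ M.
  let f : L →* MulAut (M.subgroupOf L) := MulAut.conjNormal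
  have hf : (f.ker.map L.subtype).FiniteIndex := by
    rw [Subgroup.finiteIndex_iff, Subgroup.index_map_subtype]
    exact mul_ne_zero Subgroup.FiniteIndex.index_ne_zero Subgroup.FiniteIndex.index_ne_zero
  have hle : f.ker.map L.subtype ≤ Subgroup.centralizer {x} := by
    rintro _ ⟨g, hg, rfl⟩
    refine Subgroup.mem_centralizer_iff.2 fun y hy => ?_
    rw [Set.mem_singleton_iff.1 hy]
    have h := congrArg (fun e : MulAut (M.subgroupOf L) => ((e ⟨⟨x, hML hx⟩, hx⟩ : L) : G))
      (MonoidHom.mem_ker.1 hg)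
    have h' : (g : G) * x * (g : G)⁻¹ = x := by simpa [f] using h
    exact (mul_inv_eq_iff_eq_mul.1 h').symm
  have := Subgroup.finiteIndex_of_le hle
  have hxo : IsOfFinOrder x :=
    Submonoid.isOfFinOrder_coe.2 (isOfFinOrder_of_finite (⟨x, hx⟩ : M))
  exact Subgroup.mem_bot.2 (hG.eq_one_of_isOfFinOrder hxo)

/-- The normal core K of L is just infinite, so M ∩ K has finite index in K unless it is trivial. In
that case M embeds in the finite group G/K, and a finite M normalized by L is trivial. -/
theorem HereditarilyJustInfinite.finiteIndex_of_normal (hG : JustInfinite G)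
    (hH : HereditarilyJustInfinite G) {M L : Subgroup G} [L.FiniteIndex] (hML : M ≤ L)
    (hn : ∀ g ∈ L, ∀ x ∈ M, g * x * g⁻¹ ∈ M) (hM : M ≠ ⊥) : M.FiniteIndex := by
  have hinf := hG.1
  have hK : L.normalCore ≠ ⊥ := fun h => by
    have hfi : L.normalCore.FiniteIndex := inferInstance
    rw [h] at hfi
    exact not_finite_iff_infinite.2 hinf
      ((Subgroup.finite_iff_finite_and_finiteIndex (⊥ : Subgroup G)).2 ⟨inferInstance, hfi⟩)
  have hKJ := hH L.normalCore inferInstance hK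
  have hnorm : (M.subgroupOf L.normalCore).Normal :=
    ⟨fun a ha g => hn g (L.normalCore_le g.2) a ha⟩
  have hne : M.subgroupOf L.normalCore ≠ ⊥ := fun h => by
    have h' : L.normalCore.subgroupOf M = ⊥ :=
      Subgroup.subgroupOf_eq_bot.2 (Subgroup.subgroupOf_eq_bot.1 h).symm
    have hfi : (L.normalCore.subgroupOf M).FiniteIndex := inferInstance
    rw [h'] at hfi
    have := (Subgroup.finite_iff_finite_and_finiteIndex (⊥ : Subgroup M)).2 ⟨inferInstance, hfi⟩
    exact hM (hG.eq_bot_of_finite_of_normal hML hn)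
  have hfi := hKJ.2 _ hnorm hne
  have : ((M.subgroupOf L.normalCore).map L.normalCore.subtype).FiniteIndex := by
    rw [Subgroup.finiteIndex_iff, Subgroup.index_map_subtype]
    exact mul_ne_zero hfi.index_ne_zero Subgroup.FiniteIndex.index_ne_zero
  exact Subgroup.finiteIndex_of_le (H := (M.subgroupOf L.normalCore).map L.normalCore.subtype)
    (Subgroup.map_le_iff_le_comap.2 le_rfl)

/-- Non-trivial subnormal subgroups of hereditarily just infinite groups have finite index. -/
theorem HereditarilyJustInfinite.finiteIndex_of_isSubnormal (hG : JustInfinite G)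
    (hH : HereditarilyJustInfinite G) {H : Subgroup G} (hs : H.IsSubnormal) (hne : H ≠ ⊥) :
    H.FiniteIndex := by
  induction hs with
  | top => infer_instance
  | step H K hle _ hN ih =>
    have := ih fun h => hne (le_bot_iff.1 (h ▸ hle))
    exact hH.finiteIndex_of_normal hG hle
      (fun g hg x hx => hN.conj_mem ⟨x, hle hx⟩ hx ⟨g, hg⟩) hne

/-- If `M` is normalized by `N` and finitely many conjugates of `M` meet trivially in `N ≠ ⊥`, then
some non-trivial subgroup of `N` normalized by `N` meets some conjugate of `M` trivially. -/
theorem exists_inf_conj_eq_bot {M N : Subgroup G} (hN : N.Normal) (hNbot : N ≠ ⊥)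
    (hM : ∀ g ∈ N, ∀ x ∈ M, g * x * g⁻¹ ∈ M) (S : Finset G)
    (hS : N ⊓ ⨅ g ∈ S, M.comap (MulAut.conj g).toMonoidHom = ⊥) :
    ∃ K ≤ N, K ≠ ⊥ ∧ (∀ g ∈ N, ∀ x ∈ K, g * x * g⁻¹ ∈ K) ∧
      ∃ g, K ⊓ M.comap (MulAut.conj g).toMonoidHom = ⊥ := by
  classical
  induction S using Finset.induction_on with
  | empty => exact absurd (by simpa using hS) hNbot
  | insert a S _ ih =>
    by_cases h : N ⊓ ⨅ g ∈ S, M.comap (MulAut.conj g).toMonoidHom = ⊥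
    · exact ih h
    -- The witness is the last intersection that is still non-trivial; the conjugate by a kills it.
    refine ⟨_, inf_le_left, h, fun g hg x hx => ?_, a, ?_⟩
    · rw [Subgroup.mem_inf] at hx ⊢
      refine ⟨hN.conj_mem x hx.1 g, ?_⟩
      simp only [Subgroup.mem_iInf] at hx ⊢
      intro b hb
      have := hM _ (hN.conj_mem g hg b) _ (hx.2 b hb)
      simpa [mul_assoc] using this
    · rw [← hS, Finset.iInf_insert, inf_assoc]
      congr 1
      exact inf_comm _ _

/-- A just infinite group which is not hereditarily just infinite has infinite subnormal subgroups
with trivial intersection. -/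
theorem JustInfinite.exists_isSubnormal_inf_eq_bot (hG : JustInfinite G)
    (hH : ¬ HereditarilyJustInfinite G) :
    ∃ H K : Subgroup G, H.IsSubnormal ∧ K.IsSubnormal ∧ Infinite H ∧ Infinite K ∧ H ⊓ K = ⊥ := by
  unfold HereditarilyJustInfinite at hH
  push Not at hH
  obtain ⟨N, hN, hNbot, hNJ⟩ := hH
  have := hG.2 N hN hNbot
  have hsub : ∀ K ≤ N, (∀ g ∈ N, ∀ x ∈ K, g * x * g⁻¹ ∈ K) → K ≠ ⊥ →
      K.IsSubnormal ∧ Infinite K := fun K hK hn hne =>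
    ⟨.step K N hK hN.isSubnormal ⟨fun a ha g => hn g g.2 a ha⟩,
      not_finite_iff_infinite.1 fun _ => hne (hG.eq_bot_of_finite_of_normal hK hn)⟩
  have hNinf : Infinite N := (hsub N le_rfl (fun g _ x hx => hN.conj_mem x hx g) hNbot).2
  obtain ⟨M', hM', hM'bot, hM'fin⟩ :
      ∃ M : Subgroup N, M.Normal ∧ M ≠ ⊥ ∧ ¬ M.FiniteIndex := by
    by_contra! h
    exact hNJ ⟨hNinf, h⟩
  let M := M'.map N.subtype
  have hMN : M ≤ N := Subgroup.map_subtype_le M'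
  have hMbot : M ≠ ⊥ := fun h => hM'bot ((M'.map_eq_bot_iff_of_injective N.subtype_injective).1 h)
  have hM : ∀ g ∈ N, ∀ x ∈ M, g * x * g⁻¹ ∈ M := by
    rintro g hg _ ⟨x, hx, rfl⟩
    exact ⟨_, hM'.conj_mem x hx ⟨g, hg⟩, rfl⟩
  have hcore : M.normalCore = ⊥ := by
    by_contra h
    have := hG.2 _ inferInstance h
    have : M.FiniteIndex := Subgroup.finiteIndex_of_le M.normalCore_le
    have h' : (M.subgroupOf N).FiniteIndex := inferInstance
    have hM'eq : M.subgroupOf N = M' := M'.comap_map_eq_self_of_injective N.subtype_injective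
    rw [hM'eq] at h'
    exact hM'fin h'
  -- N normalizes M, so g⁻¹Mg depends only on the coset Ng, the inverse of g⁻¹N. Finitely many
  -- conjugates thus already meet in the normal core of M.
  have hfin : (Set.range fun q : G ⧸ N => (q.out)⁻¹).Finite := Set.finite_range _
  obtain ⟨K, hKN, hKbot, hK, a, ha⟩ := exists_inf_conj_eq_bot hN hNbot hM hfin.toFinset (by
    rw [← hcore, eq_comm]
    refine le_antisymm (le_inf (M.normalCore_le.trans hMN) ?_) ?_
    · exact le_iInf₂ fun g _ x hx => M.normalCore_le
        ((inferInstance : M.normalCore.Normal).conj_mem x hx g)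
    · intro x hx g
      rw [Subgroup.mem_inf] at hx
      simp only [Subgroup.mem_iInf] at hx
      have h₁ := hx.2 ((g⁻¹ : G) : G ⧸ N).out⁻¹ (by simp)
      obtain ⟨n, hn⟩ := QuotientGroup.mk_out_eq_mul N g⁻¹
      rw [hn] at h₁
      have h₂ := hM n n.2 _ h₁
      simpa [mul_assoc] using h₂)
  obtain ⟨h₁, h₂⟩ := hsub K hKN hK hKbot
  have hcomap : M.comap (MulAut.conj a).toMonoidHom ≠ ⊥ := fun h => hMbot <| by
    rw [eq_bot_iff]
    intro x hx
    have : a⁻¹ * x * a ∈ M.comap (MulAut.conj a).toMonoidHom := by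
      simpa [mul_assoc] using hx
    rw [h, Subgroup.mem_bot] at this
    rw [Subgroup.mem_bot]
    have h3 : x = a * (a⁻¹ * x * a) * a⁻¹ := by group
    rw [h3, this]
    group
  obtain ⟨h₃, h₄⟩ := hsub (M.comap (MulAut.conj a).toMonoidHom)
    (fun x hx => by
      have := hN.conj_mem _ (hMN hx) a⁻¹
      simpa [mul_assoc] using this)
    (fun g hg x hx => by
      have := hM _ (hN.conj_mem g hg a) _ hx
      simpa [mul_assoc] using this) hcomap
  exact ⟨K, _, h₁, h₃, h₂, h₄, ha⟩

end GroupTheory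

end InvDiff

namespace InvDiff

noncomputable section

/-! ### Construction of invariant differences, and non-zero products. -/

section Means

open Filter Topology

/-- In an infinite group, any family of finite sets, indexed by a set which is not larger than the
group, has pairwise disjoint right translates. -/
theorem exists_disjoint_translates.{u} {G J : Type u} [Group G] [Infinite G]
    (hJ : Cardinal.mk J ≤ Cardinal.mk G) (F : J → Finset G) :
    ∃ t : J → G, ∀ i j, i ≠ j → ∀ a ∈ F i, ∀ b ∈ F j, a * t i ≠ b * t j := by
  classical
  -- Along a well-order of minimal type each j has fewer than |G| predecessors. Each of them forbids
  -- finitely many values of t j, so transfinite recursion never gets stuck.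
  obtain ⟨r, hwo, hr⟩ := Cardinal.exists_ord_eq J
  have key : ∀ (j : J) (f : ∀ i, r i j → G),
      ∃ x, ∀ i (h : r i j), ∀ a ∈ F i, ∀ b ∈ F j, a * f i h ≠ b * x := by
    intro j f
    let B : {i // r i j} → Set G := fun i =>
      ((F i ×ˢ F j).image fun p => p.2⁻¹ * (p.1 * f i i.2) : Finset G)
    have hcard : Cardinal.mk (⋃ i, B i) < Cardinal.mk G := by
      have hlt : Cardinal.mk {i // r i j} < Cardinal.mk G :=
        (Cardinal.card_typein_lt j hr).trans_le hJ
      rcases finite_or_infinite {i // r i j} with hfin | hinf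
      · have : (⋃ i, B i).Finite := Set.finite_iUnion fun i => Finset.finite_toSet _
        exact (Cardinal.lt_aleph0_iff_set_finite.2 this).trans_le (Cardinal.aleph0_le_mk G)
      · refine (Cardinal.mk_iUnion_le B).trans_lt (lt_of_le_of_lt ?_ hlt)
        have hle : ⨆ i, Cardinal.mk (B i) ≤ Cardinal.aleph0 := ciSup_le' fun i =>
          (Cardinal.lt_aleph0_iff_set_finite.2 (Finset.finite_toSet _)).le
        refine (mul_le_mul_right hle _).trans ?_
        rw [Cardinal.mul_aleph0_eq (Cardinal.aleph0_le_mk _)]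
    obtain ⟨x, hx⟩ : ∃ x, x ∉ ⋃ i, B i := by
      by_contra! h
      rw [Set.eq_univ_of_forall h, Cardinal.mk_univ] at hcard
      exact lt_irrefl _ hcard
    refine ⟨x, fun i h a ha b hb hab => hx (Set.mem_iUnion.2 ⟨⟨i, h⟩, ?_⟩)⟩
    refine Finset.mem_coe.2 (Finset.mem_image.2 ⟨(a, b), Finset.mem_product.2 ⟨ha, hb⟩, ?_⟩)
    change b⁻¹ * (a * f i h) = x
    rw [hab, inv_mul_cancel_left]
  choose g hg using key
  have wf : WellFounded r := IsWellFounded.wf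
  let t : J → G := wf.fix g
  have ht : ∀ i j, r i j → ∀ a ∈ F i, ∀ b ∈ F j, a * t i ≠ b * t j := by
    intro i j h a ha b hb
    have hj : t j = g j fun i _ => t i := wf.fix_eq g j
    rw [hj]
    exact hg j (fun i _ => t i) i h a ha b hb
  refine ⟨t, fun i j hij a ha b hb => ?_⟩
  rcases trichotomous_of r i j with h | h | h
  · exact ht i j h a ha b hb
  · exact absurd h hij
  · exact (ht j i h b hb a ha).symm

/-- Point masses converge weak-* along ultrafilters in the second dual of `ℓ¹(X)`. -/
theorem exists_tendsto_apply_pointMass {I X : Type*} (p : Ultrafilter I) (t : I → X) :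
    ∃ m : Bidual X, ∀ l : StrongDual ℂ (Ell1 X),
      Tendsto (fun i => l (pointMass (t i))) p (𝓝 (m l)) := by
  let e : I → WeakDual ℂ (StrongDual ℂ (Ell1 X)) := fun i =>
    StrongDual.toWeakDual (NormedSpace.inclusionInDoubleDual ℂ (Ell1 X) (pointMass (t i)))
  have hK := WeakDual.isCompact_closedBall (𝕜 := ℂ) (E := StrongDual ℂ (Ell1 X)) 0 1
  obtain ⟨m, -, hm⟩ := hK.ultrafilter_le_nhds' (p.map e) (by
    refine Ultrafilter.mem_map.2 (Filter.univ_mem' fun i => ?_)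
    change NormedSpace.inclusionInDoubleDual ℂ (Ell1 X) (pointMass (t i)) ∈ Metric.closedBall 0 1
    refine (mem_closedBall_zero_iff (E := Bidual X)).2 ?_
    refine (NormedSpace.double_dual_bound ℂ (Ell1 X) _).trans (norm_pointMass _).le)
  refine ⟨WeakDual.toStrongDual m, fun l => ?_⟩
  exact ((WeakDual.eval_continuous l).tendsto m).comp hm

variable {G : Type*} [Group G]

/-- A left-invariant mean, with the norm condition dropped. -/
def IsInvariantMean (M : Bidual G) : Prop :=
  M constOne = 1 ∧ ∀ s l, M (translate s l) = M l

/-- Translating l translates the function m · l, to which M is insensitive; m is arbitrary. -/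
theorem IsInvariantMean.box_translate {M : Bidual G} (hM : IsInvariantMean M) (m : Bidual G) (s : G)
    (l : StrongDual ℂ (Ell1 G)) : box M m (translate s l) = box M m l := by
  rw [box_apply, box_apply, ← hM.2 s (bidualAct conv m l)]
  congr 1
  exact clm_ext fun u => by
    rw [translate_pointMass, bidualAct_pointMass, bidualAct_pointMass, translate_translate]

/-- The subgroups of an amenable group have invariant means. -/
theorem Amenable.exists_isInvariantMean (hG : Amenable G) (H : Subgroup G) :
    ∃ M : Bidual H, IsInvariantMean M := by
  obtain ⟨M, -, hM1, hM⟩ := hG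
  -- Representatives of the cosets Hg give a left H-equivariant map φ from G to H, along which M is
  -- pushed forward.
  let c : G → G := fun g => (Quotient.mk (QuotientGroup.rightRel H) g).out
  have hc : ∀ g, g * (c g)⁻¹ ∈ H := fun g =>
    QuotientGroup.rightRel_apply.1 (Quotient.mk_out (s := QuotientGroup.rightRel H) g)
  have hcm : ∀ (h : H) g, c (h * g) = c g := fun h g => by
    have : Quotient.mk (QuotientGroup.rightRel H) (h * g) = Quotient.mk _ g :=
      Quotient.sound (QuotientGroup.rightRel_apply.2 (by simp))
    simp only [c, this]
  let φ : G → H := fun g => ⟨g * (c g)⁻¹, hc g⟩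
  have hφ : ∀ (h : H) g, φ (h * g) = h * φ g := fun h g =>
    Subtype.ext (by simp only [φ, hcm, Subgroup.coe_mul, mul_assoc])
  refine ⟨M.comp (adj (pushforward φ)), ?_, fun s l => ?_⟩
  · rw [ContinuousLinearMap.comp_apply, adj_apply, ← hM1]
    congr 1
    exact clm_ext fun g => by
      rw [ContinuousLinearMap.comp_apply, pushforward_pointMass, constOne_pointMass,
        constOne_pointMass]
  · rw [ContinuousLinearMap.comp_apply, ContinuousLinearMap.comp_apply,
      ← (box_delta_eq_iff (s : G) M).1 (hM s) (adj _ l)]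
    congr 1
    refine clm_ext fun g => ?_
    rw [translate_pointMass, adj_apply, adj_apply, ContinuousLinearMap.comp_apply,
      ContinuousLinearMap.comp_apply, pushforward_pointMass, pushforward_pointMass,
      translate_pointMass, hφ]

/-- An infinite group with an invariant mean has non-zero invariant differences. -/
theorem IsInvariantMean.exists_invariantDifference [Infinite G] {M : Bidual G}
    (hM : IsInvariantMean M) : ∃ Γ ∈ invariantDifferences G, ∃ l, Γ l = 1 := by
  classical
  -- Each finite set gets two translates: those labelled `true` make up the set A below, those
  -- labelled `false` avoid it.
  have hcard : Cardinal.mk (Finset G × Bool) ≤ Cardinal.mk G := by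
    rw [Cardinal.mk_prod, Cardinal.mk_finset_of_infinite, Cardinal.lift_uzero]
    refine (Cardinal.mul_eq_left (Cardinal.aleph0_le_mk G) ?_ (by simp)).le
    exact le_trans (by simp) (Cardinal.aleph0_le_mk G)
  obtain ⟨t, ht⟩ := exists_disjoint_translates hcard fun j => j.1
  let p : Ultrafilter (Finset G) := Ultrafilter.of atTop
  have hp : ∀ s : G, ∀ᶠ S in (p : Filter (Finset G)), s ∈ S := fun s =>
    (Ultrafilter.of_le atTop) ((eventually_ge_atTop {s}).mono fun S hS =>
      hS (Finset.mem_singleton_self s))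
  choose m hm using fun b : Bool => exists_tendsto_apply_pointMass p fun S => t (S, b)
  have hm1 : ∀ b, m b constOne = 1 := fun b => by
    have := hm b constOne
    simp only [constOne_pointMass] at this
    exact tendsto_nhds_unique this tendsto_const_nhds
  let A : Set G := {x | ∃ S : Finset G, ∃ s ∈ S, x = s * t (S, true)}
  let l : StrongDual ℂ (Ell1 G) := ofBounded (A.indicator fun _ => (1 : ℂ)) 1 fun x => by
    by_cases hx : x ∈ A <;> simp [hx]
  -- Once S contains s, the point s t(S, b) lies in A exactly when b is `true`, and p makes this
  -- eventual for each s.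
  have hl : ∀ b, bidualAct conv (m b) l = (if b then 1 else 0 : ℂ) • constOne := fun b => by
    refine clm_ext fun s => ?_
    rw [bidualAct_pointMass, smul_apply, constOne_pointMass, smul_eq_mul, mul_one]
    refine tendsto_nhds_unique (hm b (translate s l)) ?_
    refine tendsto_const_nhds.congr' ((hp s).mono fun S hS => ?_)
    change _ = translate s l (pointMass (t (S, b)))
    rw [translate_pointMass, ofBounded_pointMass]
    cases b with
    | true =>
      have hx : s * t (S, true) ∈ A := ⟨S, s, hS, rfl⟩
      simp [hx]
    | false =>
      have hx : s * t (S, false) ∉ A := by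
        rintro ⟨T, u, hu, h⟩
        exact ht (S, false) (T, true) (by simp) s hS u hu h
      simp [hx]
  have hbox : ∀ b, box M (m b) l = if b then 1 else 0 := fun b => by
    rw [box_apply, hl, map_smul, hM.1, smul_eq_mul, mul_one]
  have hbox1 : ∀ b, box M (m b) constOne = 1 := fun b => by
    rw [box_apply, ← hM.1]
    congr 1
    exact clm_ext fun s => by
      rw [bidualAct_pointMass, translate_constOne, hm1, constOne_pointMass]
  refine ⟨box M (m true) - box M (m false), ⟨fun s => ?_, ?_⟩, l, ?_⟩
  · rw [box_delta_eq_iff]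
    intro l
    rw [sub_apply, sub_apply, hM.box_translate, hM.box_translate]
  · rw [sub_apply, hbox1, hbox1, sub_self]
  · rw [sub_apply, hbox, hbox]
    simp

/-- Non-zero elements supported on subgroups with trivial intersection have non-zero product. -/
theorem box_bidualIncl_ne_zero {H K : Subgroup G} (hHK : H ⊓ K = ⊥) {Γ : Bidual H} {Δ : Bidual K}
    {l : StrongDual ℂ (Ell1 H)} {l' : StrongDual ℂ (Ell1 K)} (hl : Γ l = 1) (hl' : Δ l' = 1) :
    box (bidualIncl H Γ) (bidualIncl K Δ) ≠ 0 := by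
  have hinj : Function.Injective fun p : H × K => (p.1 * p.2 : G) :=
    Subgroup.mul_injective_of_disjoint (disjoint_iff.2 hHK)
  -- The test function is l(h) l'(k) at hk and 0 off HK; the product takes the value Γ(l) Δ(l') = 1
  -- on it.
  let v : G → ℂ := Function.extend (fun p : H × K => (p.1 * p.2 : G))
    (fun p => l (pointMass p.1) * l' (pointMass p.2)) 0
  have hvp : ∀ p : H × K, v (p.1 * p.2) = l (pointMass p.1) * l' (pointMass p.2) := fun p =>
    hinj.extend_apply _ _ p
  have hv : ∀ x, ‖v x‖ ≤ ‖l‖ * ‖l'‖ := fun x => by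
    by_cases hx : ∃ p : H × K, (p.1 * p.2 : G) = x
    · obtain ⟨p, rfl⟩ := hx
      rw [hvp, norm_mul]
      exact mul_le_mul (norm_apply_pointMass_le _ _) (norm_apply_pointMass_le _ _)
        (norm_nonneg _) (norm_nonneg _)
    · simp only [v]
      rw [Function.extend_apply' _ _ _ hx, Pi.zero_apply, norm_zero]
      positivity
  intro h0
  have h : box (bidualIncl H Γ) (bidualIncl K Δ) (ofBounded v _ hv) = 1 := by
    rw [box_apply, bidualIncl_eq, ← hl]
    congr 1
    refine clm_ext fun a => ?_
    rw [restrict_pointMass, bidualAct_pointMass, bidualIncl_eq]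
    have : restrict K (translate (a : G) (ofBounded v _ hv)) = l (pointMass a) • l' :=
      clm_ext fun b => by
        rw [restrict_pointMass, translate_pointMass, ofBounded_pointMass, smul_apply, smul_eq_mul]
        exact hvp (a, b)
    rw [this, map_smul, hl', smul_eq_mul, mul_one]
  rw [h0, zero_apply] at h
  exact zero_ne_one h

end Means

end

end InvDiff

/-! ### The equivalences. -/

theorem theorem4p1 (G : Type*) [Group G] (hA : InvDiff.Amenable G) (hG : InvDiff.JustInfinite G) :
    List.TFAE [InvDiff.HereditarilyJustInfinite G,
      InvDiff.boxSq (InvDiff.Jsn G) = ⊥,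
      InvDiff.boxSq (InvDiff.Asn G) = ⊥] := by
  open InvDiff in
  tfae_have 1 → 2 := by
    intro hH
    refine boxSq_span_eq_bot ?_
    rintro _ ⟨Φ, _, ⟨H, hHs, Γ, hΓ, rfl⟩, rfl⟩ _ ⟨Ψ, _, ⟨K, hKs, Δ, hΔ, rfl⟩, rfl⟩
    -- The trivial subgroup is subnormal but of infinite index, so it is treated apart.
    by_cases hHb : H = ⊥
    · rw [eq_zero_of_invariantDifference_of_eq_bot hHb hΓ, box_zero_right, box_zero_left]
    by_cases hKb : K = ⊥
    · rw [eq_zero_of_invariantDifference_of_eq_bot hKb hΔ, box_zero_right, box_zero_right]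
    have := hH.finiteIndex_of_isSubnormal hG hHs hHb
    have := hH.finiteIndex_of_isSubnormal hG hKs hKb
    exact box_box_eq_zero hΓ hΔ Φ Ψ
  tfae_have 2 → 3 := fun h => le_bot_iff.1 ((boxSq_mono Asn_le_Jsn).trans h.le)
  tfae_have 3 → 1 := by
    intro h
    by_contra hH
    obtain ⟨H, K, hHs, hKs, hHi, hKi, hHK⟩ := hG.exists_isSubnormal_inf_eq_bot hH
    obtain ⟨M, hM⟩ := hA.exists_isInvariantMean H
    obtain ⟨M', hM'⟩ := hA.exists_isInvariantMean K
    obtain ⟨Γ, hΓ, l, hl⟩ := hM.exists_invariantDifference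
    obtain ⟨Δ, hΔ, l', hl'⟩ := hM'.exists_invariantDifference
    refine box_bidualIncl_ne_zero hHK hl hl' ((Submodule.mem_bot ℂ).1 (h ▸ ?_))
    exact Submodule.subset_span ⟨_, snDifferences_subset_Asn ⟨H, hHs, Γ, hΓ, rfl⟩, _,
      snDifferences_subset_Asn ⟨K, hKs, Δ, hΔ, rfl⟩, rfl⟩
  tfae_finish
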